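/- Let $\mathbb{S}_1=\mathbb{R}/\mathbb{Z}$ be the circle of length $1$ and $d\in\mathbb{N}$. Let $\mathcal{C}$ be the set of Lipschitz curves $\gamma:\mathbb{S}_1\to\mathbb{R}^d$ with $|\gamma'|=1$ a.e. and length $\int_{\mathbb{S}_1}|\gamma'|\,dt=1$, and let $\mathcal{P}_n$ be the class of arc length parametrisations $p:\mathbb{S}_1\to\mathbb{R}^d$ of closed equilateral polygons of length $1$ with $n$ segments. For $p\in\mathcal{P}_n$ with consecutive vertices $x_1,\dots,x_n$, $x_0:=x_n$, $x_{n+1}:=x_1$, put $$\operatorname{maxCurv}(p):=\max_{1\le i\le n}\kappa_d(x_{i-1},x_i,x_{i+1}),\qquad \kappa_d(x,y,z):=\frac{2\tan(\phi/2)}{\tfrac12(|x-y|+|z-y|)},$$ where $\phi=\measuredangle(y-x,z-y)\in[0,\pi]$ is the exterior angle at $y$ and $\kappa_d(x,y,z):=\infty$ if $\phi=\pi$. For a $C^{1,1}$ curve $\gamma\in\mathcal{C}$ put $\operatorname{maxCurv}(\gamma):=\|\gamma''\|_{L^\infty}$. Proposition (Compactness). Let $n_0\in\mathbb{N}$ and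 let $p_n\in\mathcal{P}_n$, $n\ge n_0$, be bounded in $L^\infty$ with $\liminf_{n\to\infty}\operatorname{maxCurv}(p_n)<\infty$. Then there are $\gamma\in C^{1,1}(\mathbb{S}_1,\mathbb{R}^d)\cap\mathcal{C}$ and a subsequence $p_{n_k}$ such that $$p_{n_k}\to\gamma\ \text{ in } W^{1,\infty}(\mathbb{S}_1,\mathbb{R}^d)\ \text{ as } k\to\infty\qquad\text{and}\qquad \operatorname{maxCurv}(\gamma)\le\liminf_{n\to\infty}\operatorname{maxCurv}(p_n).$$ In particular this holds if all $p_n$ belong to a fixed knot class. -/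

import Mathlib

open Filter Topology MeasureTheory
open scoped ENNReal NNReal

namespace DiscreteThickness

/-- The derivative of a map `γ` defined on the circle `ℝ / ℤ` of length `1`: its derivative at `t`
along the local coordinate `h ↦ t + h`, with the value `0` where this derivative does not exist. -/
noncomputable def circleDeriv {d : ℕ} (γ : UnitAddCircle → EuclideanSpace ℝ (Fin d)) :
    UnitAddCircle → EuclideanSpace ℝ (Fin d) :=
  fun t => deriv (fun h : ℝ => γ (t + (h : UnitAddCircle))) 0

/-- The `W^{1,∞}` norm of a Lipschitz map `f` on the circle of length `1`. For Lipschitz maps the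
weak derivative is the classical one, which exists almost everywhere. -/
noncomputable def sobolevNorm {d : ℕ} (f : UnitAddCircle → EuclideanSpace ℝ (Fin d)) : ℝ≥0∞ :=
  eLpNorm f ∞ volume + eLpNorm (circleDeriv f) ∞ volume

/-- The class of closed curves of length `1` parametrised by arc length. -/
structure IsArcLengthCurve {d : ℕ} (γ : UnitAddCircle → EuclideanSpace ℝ (Fin d)) : Prop where
  lipschitz : ∃ L : ℝ≥0, LipschitzWith L γ
  unit_speed : ∀ᵐ t : UnitAddCircle, ‖circleDeriv γ t‖ = 1
  length_eq_one : ∫⁻ t : UnitAddCircle, ‖circleDeriv γ t‖ₑ = 1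

/-- The class `C^{1,1}`: continuously differentiable with a Lipschitz derivative. -/
structure IsC11 {d : ℕ} (γ : UnitAddCircle → EuclideanSpace ℝ (Fin d)) : Prop where
  contDiff : ContDiff ℝ 1 (fun t : ℝ => γ (t : UnitAddCircle))
  lipschitz_deriv : ∃ L : ℝ≥0, LipschitzWith L (circleDeriv γ)

/-- The maximal curvature `‖γ''‖_{L^∞}` of a `C^{1,1}` arc length curve. -/
noncomputable def maxCurv {d : ℕ} (γ : UnitAddCircle → EuclideanSpace ℝ (Fin d)) : ℝ≥0∞ :=
  eLpNorm (circleDeriv (circleDeriv γ)) ∞ volume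

/-- The discrete curvature at the vertex `y` with adjacent vertices `x` and `z`, i.e.
`2 tan (φ / 2) / ((|x - y| + |z - y|) / 2)` with the exterior angle `φ = ∡ (y - x, z - y)`.
It is infinite if `φ = π`. -/
noncomputable def discreteCurvature {d : ℕ} (x y z : EuclideanSpace ℝ (Fin d)) : ℝ≥0∞ :=
  open Classical in
  if InnerProductGeometry.angle (y - x) (z - y) = Real.pi then ∞
  else ENNReal.ofReal
    (2 * Real.tan (InnerProductGeometry.angle (y - x) (z - y) / 2) /
      ((‖x - y‖ + ‖z - y‖) / 2))

/-- Arc length parametrisations of closed equilateral polygons of length `1` with `n` segments in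
`ℝ^d`. The vertices are the points at the parameters `start + i / n`, consecutive vertices have
distance `1 / n`, and the parametrisation is affine between them. -/
structure EquilateralPolygon (d n : ℕ) where
  toFun : UnitAddCircle → EuclideanSpace ℝ (Fin d)
  start : ℝ
  pos : 0 < n
  edge_length : ∀ i : ℤ,
    ‖toFun ((start + (i + 1) / n : ℝ) : UnitAddCircle)
      - toFun ((start + i / n : ℝ) : UnitAddCircle)‖ = 1 / n
  affine_on_edge : ∀ (i : ℤ) (s : ℝ), 0 ≤ s → s ≤ 1 →
    toFun ((start + (i + s) / n : ℝ) : UnitAddCircle)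
      = (1 - s) • toFun ((start + i / n : ℝ) : UnitAddCircle)
        + s • toFun ((start + (i + 1) / n : ℝ) : UnitAddCircle)

namespace EquilateralPolygon

/-- The `i`-th vertex; `i` is counted modulo `n`. -/
noncomputable def vertex {d n : ℕ} (p : EquilateralPolygon d n) (i : ℤ) :
    EuclideanSpace ℝ (Fin d) :=
  p.toFun ((p.start + i / n : ℝ) : UnitAddCircle)

/-- The maximal discrete curvature of a polygon, over its vertices `x₁, …, xₙ`. -/
noncomputable def maxCurv {d n : ℕ} (p : EquilateralPolygon d n) : ℝ≥0∞ :=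
  ⨆ i ∈ Finset.Icc (1 : ℤ) n,
    discreteCurvature (p.vertex (i - 1)) (p.vertex i) (p.vertex (i + 1))

end EquilateralPolygon

end DiscreteThickness

/-! A curvature bound `C` forces consecutive unit tangents of an `n`-gon to differ by at most `C /
n`, because the chord `2 sin (φ / 2)` is at most `2 tan (φ / 2)`. The tangent, a step function, is
therefore `C`-Lipschitz up to an error `C / n` (`norm_rightTangent_sub_le`), and integration gives a
first-order expansion of the polygon with quadratic error (`norm_lift_add_sub_sub_le`).

Polygons are 1-Lipschitz, so Arzelà–Ascoli yields a uniform limit. The expansion turns uniform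
convergence of the curves into uniform convergence of the tangents: difference quotients at a small
fixed scale determine the tangents up to a small error (`exists_hasDerivAt_of_tendstoUniformly`).
The limiting tangent is the derivative of the limit curve and has unit length. As the error `C / n`
vanishes, its Lipschitz constant is the limit of the curvature bounds, with no loss. Choosing bounds
that decrease to the liminf gives the sharp inequality. -/

namespace DiscreteThickness

/-! ### Discrete curvature and the jump between consecutive edges -/

/-- The length of the difference of two vectors of the same length `r`. -/
theorem norm_sub_eq_two_mul_sin_half_angle {V : Type*} [NormedAddCommGroup V]
    [InnerProductSpace ℝ V] {a b : V} {r : ℝ} (ha : ‖a‖ = r) (hb : ‖b‖ = r) :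
    ‖b - a‖ = 2 * r * Real.sin (InnerProductGeometry.angle a b / 2) := by
  have hr : 0 ≤ r := ha ▸ norm_nonneg a
  set φ := InnerProductGeometry.angle a b with hφ
  have h0 : 0 ≤ φ := InnerProductGeometry.angle_nonneg a b
  have h1 : φ ≤ Real.pi := InnerProductGeometry.angle_le_pi a b
  have hs : 0 ≤ Real.sin (φ / 2) := Real.sin_nonneg_of_nonneg_of_le_pi (by linarith) (by linarith)
  have hc : Real.cos φ = 1 - 2 * Real.sin (φ / 2) ^ 2 := by
    rw [show φ = 2 * (φ / 2) by ring, Real.cos_two_mul, Real.cos_sq',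
      show 2 * (φ / 2) / 2 = φ / 2 by ring]
    ring
  have key : ‖b - a‖ ^ 2 = (2 * r * Real.sin (φ / 2)) ^ 2 := by
    rw [norm_sub_sq_real, real_inner_comm, ← InnerProductGeometry.cos_angle_mul_norm_mul_norm,
      ha, hb, ← hφ, hc]
    ring
  exact (pow_left_inj₀ (norm_nonneg _) (by positivity) two_ne_zero).1 key

/-- Two consecutive edges of the same length `r` differ by at most `r ^ 2` times the discrete
curvature at their common vertex. -/
theorem norm_sub_le_of_discreteCurvature_le {d : ℕ} {x y z : EuclideanSpace ℝ (Fin d)} {r C : ℝ}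
    (hr : 0 < r) (hC : 0 ≤ C) (hxy : ‖y - x‖ = r) (hyz : ‖z - y‖ = r)
    (h : discreteCurvature x y z ≤ ENNReal.ofReal C) :
    ‖(z - y) - (y - x)‖ ≤ C * r ^ 2 := by
  unfold discreteCurvature at h
  set φ := InnerProductGeometry.angle (y - x) (z - y) with hφ
  split_ifs at h with hpi
  · simp at h
  have h0 : 0 ≤ φ := InnerProductGeometry.angle_nonneg _ _
  have h1 : φ < Real.pi := lt_of_le_of_ne (InnerProductGeometry.angle_le_pi _ _) hpi
  have hc : 0 < Real.cos (φ / 2) := Real.cos_pos_of_mem_Ioo ⟨by linarith, by linarith⟩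
  have ht : 0 ≤ Real.tan (φ / 2) :=
    Real.tan_nonneg_of_nonneg_of_le_pi_div_two (by linarith) (by linarith)
  rw [ENNReal.ofReal_le_ofReal_iff hC, norm_sub_rev x y, hxy, hyz,
    show (r + r) / 2 = r by ring, div_le_iff₀ hr] at h
  -- The jump is `2 r sin (φ / 2)` while `h` bounds `2 tan (φ / 2)` by `C r`; writing `sin = tan *
  -- cos` gives `sin ≤ tan`.
  rw [norm_sub_eq_two_mul_sin_half_angle hxy hyz, ← hφ, ← Real.tan_mul_cos hc.ne']
  have : Real.tan (φ / 2) * Real.cos (φ / 2) ≤ Real.tan (φ / 2) :=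
    mul_le_of_le_one_right ht (Real.cos_le_one _)
  nlinarith

/-! ### Tangents of polygons and quantitative first-order expansion -/

namespace EquilateralPolygon

variable {d n : ℕ} (p : EquilateralPolygon d n)

theorem cast_pos {d n : ℕ} (p : EquilateralPolygon d n) : (0 : ℝ) < n := Nat.cast_pos.2 p.pos

/-- The lift of the parametrisation to the real line. -/
noncomputable def lift (x : ℝ) : EuclideanSpace ℝ (Fin d) := p.toFun (x : UnitAddCircle)

/-- The unit vector in the direction of the edge from the `i`-th vertex to the next one. -/
noncomputable def tangent (i : ℤ) : EuclideanSpace ℝ (Fin d) :=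
  (n : ℝ) • (p.vertex (i + 1) - p.vertex i)

/-- The tangent of the edge that starts at or contains the point at the parameter `x`. -/
noncomputable def rightTangent (x : ℝ) : EuclideanSpace ℝ (Fin d) :=
  p.tangent ⌊n * (x - p.start)⌋

theorem norm_vertex_sub (i : ℤ) : ‖p.vertex (i + 1) - p.vertex i‖ = 1 / n := by
  simpa [vertex] using p.edge_length i

theorem norm_tangent (i : ℤ) : ‖p.tangent i‖ = 1 := by
  have := p.cast_pos
  rw [tangent, norm_smul, p.norm_vertex_sub, Real.norm_of_nonneg this.le]
  field_simp

theorem norm_rightTangent (x : ℝ) : ‖p.rightTangent x‖ = 1 := p.norm_tangent _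

theorem vertex_add_mul (i m : ℤ) : p.vertex (i + n * m) = p.vertex i := by
  have := p.cast_pos
  unfold vertex
  congr 1
  rw [← sub_eq_zero, ← AddCircle.coe_sub, AddCircle.coe_eq_zero_iff]
  refine ⟨m, ?_⟩
  push_cast
  rw [zsmul_eq_mul]
  field_simp
  ring

theorem discreteCurvature_le_maxCurv (i : ℤ) :
    discreteCurvature (p.vertex (i - 1)) (p.vertex i) (p.vertex (i + 1)) ≤ p.maxCurv := by
  have hn : (0 : ℤ) < n := by exact_mod_cast p.pos
  -- The shift by one puts the representative of `i` modulo `n` in `1, …, n`, the range of the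
  -- supremum.
  set j := (i - 1) % n + 1 with hj
  set m := (i - 1) / n with hm
  have hi : i = j + n * m := by
    have := Int.emod_add_mul_ediv (i - 1) n
    rw [hj, hm]; linarith
  have hjm : j ∈ Finset.Icc (1 : ℤ) n := by
    have h1 := Int.emod_nonneg (i - 1) hn.ne'
    have h2 := Int.emod_lt_of_pos (i - 1) hn
    rw [Finset.mem_Icc]; omega
  have e1 : i - 1 = (j - 1) + n * m := by rw [hi]; ring
  have e2 : i + 1 = (j + 1) + n * m := by rw [hi]; ring
  rw [e1, e2, hi, vertex_add_mul, vertex_add_mul, vertex_add_mul]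
  exact le_iSup₂_of_le j hjm le_rfl

variable {p} {C : ℝ}

theorem norm_tangent_succ_sub_le (hC : 0 ≤ C) (h : p.maxCurv ≤ ENNReal.ofReal C) (i : ℤ) :
    ‖p.tangent (i + 1) - p.tangent i‖ ≤ C / n := by
  have hn := p.cast_pos
  have h1 := norm_sub_le_of_discreteCurvature_le (one_div_pos.2 hn) hC (p.norm_vertex_sub i)
    (p.norm_vertex_sub (i + 1)) (by
      have := p.discreteCurvature_le_maxCurv (i + 1)
      rw [add_sub_cancel_right] at this
      exact this.trans h)
  rw [tangent, tangent, ← smul_sub, norm_smul, Real.norm_of_nonneg hn.le]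
  calc _ ≤ n * (C * (1 / n) ^ 2) := by gcongr
    _ = C / n := by field_simp

theorem norm_tangent_sub_le (hC : 0 ≤ C) (h : p.maxCurv ≤ ENNReal.ofReal C) (i j : ℤ) :
    ‖p.tangent i - p.tangent j‖ ≤ C / n * |(i - j : ℝ)| := by
  have key : ∀ (j : ℤ) (m : ℕ), ‖p.tangent (j + m) - p.tangent j‖ ≤ C / n * m := by
    intro j m
    induction m with
    | zero => simp
    | succ m ih =>
      have := norm_tangent_succ_sub_le hC h (j + m)
      have h2 := norm_sub_le_norm_sub_add_norm_sub (p.tangent (j + m + 1)) (p.tangent (j + m))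
        (p.tangent j)
      push_cast
      rw [← add_assoc]
      linarith
  rcases le_total j i with hij | hij
  · obtain ⟨m, rfl⟩ := Int.le.dest hij
    simpa using key j m
  · obtain ⟨m, rfl⟩ := Int.le.dest hij
    rw [norm_sub_rev]
    simpa using key i m

/-- Taking floors costs at most one edge, hence the additive `1 / n`; the factor `C` of the distance
stays sharp. -/
theorem norm_rightTangent_sub_le (hC : 0 ≤ C) (h : p.maxCurv ≤ ENNReal.ofReal C) (x y : ℝ) :
    ‖p.rightTangent x - p.rightTangent y‖ ≤ C * (|x - y| + 1 / n) := by
  have hn := p.cast_pos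
  refine (norm_tangent_sub_le hC h _ _).trans ?_
  have hfl : ∀ a b : ℝ, |((⌊a⌋ : ℝ) - ⌊b⌋)| ≤ |a - b| + 1 := by
    intro a b
    have h1 := Int.floor_le a
    have h2 := Int.lt_floor_add_one a
    have h3 := Int.floor_le b
    have h4 := Int.lt_floor_add_one b
    have h5 := abs_le.1 (le_refl |a - b|)
    rw [abs_le]
    constructor <;> linarith
  calc _ ≤ C / n * (|n * (x - p.start) - n * (y - p.start)| + 1) := by gcongr; exact hfl _ _
    _ = C * (|x - y| + 1 / n) := by
      rw [← mul_sub, abs_mul, abs_of_pos hn, sub_sub_sub_cancel_right]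
      field_simp

variable (p)

theorem lift_eq_of_mem_Icc (i : ℤ) {x : ℝ}
    (hx : n * (x - p.start) ∈ Set.Icc (i : ℝ) (i + 1)) :
    p.lift x = p.vertex i + (x - (p.start + i / n)) • p.tangent i := by
  have hn := p.cast_pos
  have h := p.affine_on_edge i (n * (x - p.start) - i) (by linarith [hx.1]) (by linarith [hx.2])
  have hx' : p.start + (i + (n * (x - p.start) - i)) / n = x := by field_simp; ring
  have hv : p.toFun ((p.start + (i + 1) / n : ℝ) : UnitAddCircle) = p.vertex (i + 1) := by
    simp [vertex]
  rw [hx', hv] at h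
  change p.toFun _ = _
  rw [h, tangent, smul_smul, show (x - (p.start + i / n)) * n = n * (x - p.start) - i by
    field_simp; ring]
  change _ • p.vertex i + _ = _
  module

/-- A right derivative exists at vertices too, so the one-sided mean value inequality applies
without exceptional points. -/
theorem hasDerivWithinAt_lift (x : ℝ) :
    HasDerivWithinAt p.lift (p.rightTangent x) (Set.Ici x) x := by
  have hn := p.cast_pos
  set i := ⌊n * (x - p.start)⌋ with hi
  have h1 : (i : ℝ) ≤ n * (x - p.start) := Int.floor_le _
  have h2 : n * (x - p.start) < i + 1 := Int.lt_floor_add_one _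
  have hd : HasDerivAt (fun y : ℝ => p.vertex i + (y - (p.start + i / n)) • p.tangent i)
      (p.rightTangent x) x := by
    have := (((hasDerivAt_id x).sub_const (p.start + i / n)).smul_const (p.tangent i)).const_add
      (p.vertex i)
    simpa [rightTangent, ← hi] using this
  refine hd.hasDerivWithinAt.congr_of_eventuallyEq ?_ (p.lift_eq_of_mem_Icc i ⟨h1, h2.le⟩)
  have hc : ContinuousAt (fun y : ℝ => n * (y - p.start)) x := by fun_prop
  filter_upwards [self_mem_nhdsWithin, nhdsWithin_le_nhds (hc.eventually (gt_mem_nhds h2))]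
    with y hy hy'
  have hy : x ≤ y := hy
  exact p.lift_eq_of_mem_Icc i ⟨h1.trans (by gcongr), hy'.le⟩

theorem continuous_lift : Continuous p.lift := by
  have hn := p.cast_pos
  rw [continuous_iff_continuousAt]
  intro x
  rw [continuousAt_iff_continuous_left_right]
  refine ⟨?_, (p.hasDerivWithinAt_lift x).continuousWithinAt⟩
  -- At a vertex, this selects the edge that ends there, as left continuity requires.
  set i := ⌈n * (x - p.start)⌉ - 1 with hi
  have h1 : (i : ℝ) < n * (x - p.start) := by
    have := Int.ceil_lt_add_one (n * (x - p.start)); rw [hi]; push_cast; linarith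
  have h2 : n * (x - p.start) ≤ i + 1 := by
    have := Int.le_ceil (n * (x - p.start)); rw [hi]; push_cast; linarith
  have hd : Continuous (fun y : ℝ => p.vertex i + (y - (p.start + i / n)) • p.tangent i) := by
    fun_prop
  refine hd.continuousWithinAt.congr_of_eventuallyEq ?_ (p.lift_eq_of_mem_Icc i ⟨h1.le, h2⟩)
  have hc : ContinuousAt (fun y : ℝ => n * (y - p.start)) x := by fun_prop
  filter_upwards [self_mem_nhdsWithin, nhdsWithin_le_nhds (hc.eventually (lt_mem_nhds h1))]
    with y hy hy'
  have hy : y ≤ x := hy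
  exact p.lift_eq_of_mem_Icc i ⟨hy'.le, le_trans (by gcongr) h2⟩

theorem norm_lift_sub_le (x y : ℝ) : ‖p.lift x - p.lift y‖ ≤ |x - y| := by
  have key : ∀ a b, a ≤ b → ‖p.lift b - p.lift a‖ ≤ 1 * (b - a) := fun a b hab =>
    norm_image_sub_le_of_norm_deriv_right_le_segment p.continuous_lift.continuousOn
      (fun z _ => p.hasDerivWithinAt_lift z) (fun z _ => (p.norm_rightTangent z).le) b ⟨hab, le_rfl⟩
  rcases le_total y x with h | h
  · simpa [abs_of_nonneg (sub_nonneg.2 h)] using key y x h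
  · rw [norm_sub_rev, abs_sub_comm]
    simpa [abs_of_nonneg (sub_nonneg.2 h)] using key x y h

variable {p}

/-- Mean value inequality for the lift minus its tangent line at `x`: the right derivative is a
difference of tangents at distance at most `t`. -/
theorem norm_lift_add_sub_sub_le (hC : 0 ≤ C) (h : p.maxCurv ≤ ENNReal.ofReal C) (x : ℝ) {t : ℝ}
    (ht : 0 ≤ t) :
    ‖p.lift (x + t) - p.lift x - t • p.rightTangent x‖ ≤ C * (t + 1 / n) * t := by
  have hn := p.cast_pos
  have := norm_image_sub_le_of_norm_deriv_right_le_segment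
    (f := fun y => p.lift y - y • p.rightTangent x)
    (f' := fun y => p.rightTangent y - p.rightTangent x) (a := x) (b := x + t)
    (C := C * (t + 1 / n))
    (by have := p.continuous_lift; fun_prop)
    (fun z _ => (p.hasDerivWithinAt_lift z).sub
      (by simpa using ((hasDerivWithinAt_id z (Set.Ici z)).smul_const (p.rightTangent x))))
    (fun z hz => (norm_rightTangent_sub_le hC h z x).trans (by
      rw [abs_of_nonneg (sub_nonneg.2 hz.1)]
      gcongr
      linarith [hz.2]))
    (x + t) ⟨by linarith, le_rfl⟩
  rw [add_sub_cancel_left] at this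
  rwa [add_smul, show p.lift (x + t) - (x • p.rightTangent x + t • p.rightTangent x)
      - (p.lift x - x • p.rightTangent x) = p.lift (x + t) - p.lift x - t • p.rightTangent x by
    module] at this

end EquilateralPolygon

end DiscreteThickness

/-! ### Passage between circle and line, and convergence of derivatives -/

namespace DiscreteThickness

/-- Representatives realising the circle distance let Lipschitz constants descend from the line
unchanged. -/
theorem exists_lift_of_dist (u v : UnitAddCircle) :
    ∃ x y : ℝ, (x : UnitAddCircle) = u ∧ (y : UnitAddCircle) = v ∧ |x - y| = dist u v := by
  obtain ⟨x, rfl⟩ := QuotientAddGroup.mk_surjective u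
  obtain ⟨y, rfl⟩ := QuotientAddGroup.mk_surjective v
  refine ⟨x, y + round (x - y), rfl, ?_, ?_⟩
  · rw [← sub_eq_zero]
    change ((y + round (x - y) - y : ℝ) : UnitAddCircle) = 0
    rw [AddCircle.coe_eq_zero_iff]
    exact ⟨round (x - y), by simp⟩
  · rw [dist_eq_norm]
    change _ = ‖((x - y : ℝ) : UnitAddCircle)‖
    rw [UnitAddCircle.norm_eq, sub_sub]

/-- A map on the circle is Lipschitz if its lift to the real line is. -/
theorem lipschitzWith_of_lift {E : Type*} [SeminormedAddCommGroup E] {f : UnitAddCircle → E}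
    {C : ℝ≥0} (h : ∀ x y : ℝ, ‖f x - f y‖ ≤ C * |x - y|) : LipschitzWith C f := by
  refine LipschitzWith.of_dist_le_mul fun u v => ?_
  obtain ⟨x, y, rfl, rfl, hxy⟩ := exists_lift_of_dist u v
  rw [← hxy, dist_eq_norm]
  exact h x y

theorem circleDeriv_coe {d : ℕ} (γ : UnitAddCircle → EuclideanSpace ℝ (Fin d)) (x : ℝ) :
    circleDeriv γ (x : UnitAddCircle) = deriv (fun y : ℝ => γ (y : UnitAddCircle)) x := by
  have := deriv_comp_const_add (f := fun y : ℝ => γ (y : UnitAddCircle)) x 0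
  simpa [circleDeriv] using this

/-- Where the two-sided derivative fails to exist, as at vertices, the default value `0` keeps the
bound true. -/
theorem norm_circleDeriv_le_of_hasDerivWithinAt {d : ℕ}
    {γ : UnitAddCircle → EuclideanSpace ℝ (Fin d)} {x : ℝ} {v : EuclideanSpace ℝ (Fin d)}
    (h : HasDerivWithinAt (fun y : ℝ => γ (y : UnitAddCircle)) v (Set.Ici x) x) :
    ‖circleDeriv γ (x : UnitAddCircle)‖ ≤ ‖v‖ := by
  rw [circleDeriv_coe]
  by_cases hd : DifferentiableAt ℝ (fun y : ℝ => γ (y : UnitAddCircle)) x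
  · rw [(uniqueDiffWithinAt_Ici x).eq_deriv _ hd.hasDerivAt.hasDerivWithinAt h]
  · simp [deriv_zero_of_not_differentiableAt hd]

theorem norm_circleDeriv_le_of_lipschitzWith {d : ℕ}
    {γ : UnitAddCircle → EuclideanSpace ℝ (Fin d)} {C : ℝ} (hC : 0 ≤ C)
    (h : ∀ x y : ℝ, ‖γ x - γ y‖ ≤ C * |x - y|) (u : UnitAddCircle) : ‖circleDeriv γ u‖ ≤ C := by
  obtain ⟨x, rfl⟩ := QuotientAddGroup.mk_surjective u
  refine (circleDeriv_coe γ x).symm ▸ ?_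
  exact norm_deriv_le_of_lip' hC (Eventually.of_forall fun y => h y x)

/-- If `F l → f` uniformly and the `F l` have approximate derivatives `T l` with a uniform
quadratic error and an approximate Lipschitz bound, then the `T l` converge uniformly to the
derivative of `f`, which is Lipschitz. -/
theorem exists_hasDerivAt_of_tendstoUniformly {E : Type*} [NormedAddCommGroup E] [NormedSpace ℝ E]
    [CompleteSpace E] {F T : ℕ → ℝ → E} {f : ℝ → E} {C r : ℕ → ℝ} {K : ℝ}
    (hC : ∀ l, 0 ≤ C l) (hCK : Tendsto C atTop (𝓝 K)) (hr₀ : ∀ l, 0 ≤ r l) (hr : Tendsto r atTop (𝓝 0))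
    (hF : TendstoUniformly F f atTop)
    (hFT : ∀ l x t, 0 ≤ t → ‖F l (x + t) - F l x - t • T l x‖ ≤ C l * (t + r l) * t)
    (hT : ∀ l x y, ‖T l x - T l y‖ ≤ C l * (|x - y| + r l)) :
    ∃ g : ℝ → E, TendstoUniformly T g atTop ∧ (∀ x y, ‖g x - g y‖ ≤ K * |x - y|) ∧
      ∀ x, HasDerivAt f (g x) x := by
  have hK : 0 ≤ K := ge_of_tendsto' hCK hC
  have hcauchy : UniformCauchySeqOn T atTop Set.univ := by
    rw [Metric.uniformCauchySeqOn_iff]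
    intro ε hε
    set B := K + 1 with hB
    have hBpos : 0 < B := by positivity
    -- The scale of the difference quotient: tangents will agree up to `8 * B * h = ε / 2`.
    set h := ε / (16 * B) with hh
    have hpos : 0 < h := by positivity
    have hδ : 0 < B * h ^ 2 := by positivity
    obtain ⟨N, hN⟩ := eventually_atTop.1 ((hCK.eventually (gt_mem_nhds (lt_add_one K))).and
      ((hr.eventually (gt_mem_nhds hpos)).and (Metric.tendstoUniformly_iff.1 hF _ hδ)))
    refine ⟨N, fun m hm n hn x _ => ?_⟩
    -- Replacing `F l` by `f` at two points costs `2 B h²`; since `r l < h`, the expansion error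
    -- costs another `2 B h²`.
    have key : ∀ l ≥ N, ‖f (x + h) - f x - h • T l x‖ ≤ 4 * (B * h ^ 2) := by
      intro l hl
      obtain ⟨h1, h2, h3⟩ := hN l hl
      have ha := h3 (x + h)
      have hb := h3 x
      have hc := hFT l x h hpos.le
      rw [dist_eq_norm] at ha hb
      have hd : C l * (h + r l) * h ≤ B * (h + h) * h :=
        mul_le_mul_of_nonneg_right
          (mul_le_mul h1.le (by linarith) (by linarith [hr₀ l]) hBpos.le) hpos.le
      calc ‖f (x + h) - f x - h • T l x‖
          = ‖(f (x + h) - F l (x + h)) - (f x - F l x)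
              + (F l (x + h) - F l x - h • T l x)‖ := by congr 1; abel
        _ ≤ ‖f (x + h) - F l (x + h)‖ + ‖f x - F l x‖
              + ‖F l (x + h) - F l x - h • T l x‖ :=
            (norm_add_le _ _).trans (add_le_add_left (norm_sub_le _ _) _)
        _ ≤ 4 * (B * h ^ 2) := by nlinarith
    have h1 := key m hm
    have h2 := key n hn
    have h3 : h * ‖T m x - T n x‖ ≤ 8 * (B * h ^ 2) := by
      calc h * ‖T m x - T n x‖ = ‖h • (T m x - T n x)‖ := by
            rw [norm_smul, Real.norm_of_nonneg hpos.le]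
        _ = ‖(f (x + h) - f x - h • T n x) - (f (x + h) - f x - h • T m x)‖ := by
            rw [smul_sub]; congr 1; abel
        _ ≤ _ := (norm_sub_le _ _).trans (by linarith)
    have h4 : ‖T m x - T n x‖ ≤ 8 * B * h := by
      refine le_of_mul_le_mul_left (h3.trans_eq ?_) hpos
      ring
    rw [dist_eq_norm]
    have h5 : 8 * B * h = ε / 2 := by rw [hh]; field_simp; norm_num
    linarith
  choose g hg using fun x => cauchySeq_tendsto_of_complete (hcauchy.cauchySeq (Set.mem_univ x))
  have hTg : TendstoUniformly T g atTop :=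
    tendstoUniformlyOn_univ.1 (hcauchy.tendstoUniformlyOn_of_tendsto fun x _ => hg x)
  have hglip : ∀ x y, ‖g x - g y‖ ≤ K * |x - y| := by
    intro x y
    have hlim := hCK.mul (hr.const_add |x - y|)
    rw [add_zero] at hlim
    exact le_of_tendsto_of_tendsto' ((hg x).sub (hg y)).norm hlim fun l => hT l x y
  have hfwd : ∀ x t, 0 ≤ t → ‖f (x + t) - f x - t • g x‖ ≤ K * t * t := by
    intro x t ht
    have hlim := (hCK.mul (hr.const_add t)).mul_const t
    rw [add_zero] at hlim
    exact le_of_tendsto_of_tendsto' ((((hF.tendsto_at (x + t)).sub (hF.tendsto_at x)).sub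
      ((hg x).const_smul t)).norm) hlim fun l => hFT l x t ht
  refine ⟨g, hTg, hglip, fun x => ?_⟩
  -- The expansion `hfwd` only looks forward. For `y ≤ x` it is applied from `y`, and moving the
  -- tangent from `y` to `x` doubles the constant.
  have hquad : ∀ y, ‖f y - f x - (y - x) • g x‖ ≤ 2 * K * ‖|y - x| ^ 2‖ := by
    intro y
    rw [Real.norm_of_nonneg (by positivity)]
    rcases le_total x y with hxy | hxy
    · have := hfwd x (y - x) (by linarith)
      rw [add_sub_cancel] at this
      rw [abs_of_nonneg (by linarith)]
      nlinarith [mul_nonneg hK (sq_nonneg (y - x))]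
    · have h1 := hfwd y (x - y) (by linarith)
      rw [add_sub_cancel] at h1
      have h2 := hglip y x
      rw [abs_of_nonpos (by linarith), neg_sub] at h2 ⊢
      calc ‖f y - f x - (y - x) • g x‖
          = ‖-(f x - f y - (x - y) • g y) - (x - y) • (g y - g x)‖ := by congr 1; module
        _ ≤ ‖f x - f y - (x - y) • g y‖ + (x - y) * ‖g y - g x‖ := by
            refine (norm_sub_le _ _).trans_eq ?_
            rw [norm_neg, norm_smul, Real.norm_of_nonneg (by linarith)]
        _ ≤ K * (x - y) * (x - y) + (x - y) * (K * (x - y)) :=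
            add_le_add h1 (mul_le_mul_of_nonneg_left h2 (by linarith))
        _ = 2 * K * (x - y) ^ 2 := by ring
  rw [hasDerivAt_iff_isLittleO]
  exact (Asymptotics.IsBigO.of_bound _ (Eventually.of_forall hquad)).trans_isLittleO
    (Asymptotics.isLittleO_pow_sub_sub x one_lt_two)

end DiscreteThickness

/-! ### Arzelà–Ascoli and properties of the limit curve -/

namespace DiscreteThickness

namespace EquilateralPolygon

variable {d n : ℕ} (p : EquilateralPolygon d n)

theorem lipschitzWith_toFun : LipschitzWith 1 p.toFun :=
  lipschitzWith_of_lift fun x y => by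
    rw [NNReal.coe_one, one_mul]; exact p.norm_lift_sub_le x y

/-- The parametrisation as a bounded continuous function on the circle. -/
noncomputable def toBoundedContinuousFunction :
    BoundedContinuousFunction UnitAddCircle (EuclideanSpace ℝ (Fin d)) :=
  BoundedContinuousFunction.mkOfCompact ⟨p.toFun, p.lipschitzWith_toFun.continuous⟩

theorem norm_toFun_le_of_eLpNorm_le {M : ℝ≥0} (h : eLpNorm p.toFun ∞ volume ≤ M)
    (u : UnitAddCircle) : ‖p.toFun u‖ ≤ M := by
  rw [eLpNorm_exponent_top] at h
  have hae : ∀ᵐ u : UnitAddCircle, ‖p.toFun u‖ ≤ M := by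
    filter_upwards [ae_le_eLpNormEssSup (f := p.toFun) (μ := volume)] with u hu
    have := hu.trans h
    rw [enorm_le_coe] at this
    exact_mod_cast this
  -- By continuity, the set where the bound holds is closed; having full measure, it is also dense,
  -- hence everything.
  have hcl : IsClosed {u : UnitAddCircle | ‖p.toFun u‖ ≤ M} :=
    isClosed_le p.lipschitzWith_toFun.continuous.norm continuous_const
  have := (Measure.dense_of_ae hae).closure_eq
  rw [hcl.closure_eq] at this
  exact this.ge (Set.mem_univ u)

end EquilateralPolygon

theorem isCompact_closure_range_toBoundedContinuousFunction {d : ℕ} {N : ℕ → ℕ}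
    (q : ∀ l, EquilateralPolygon d (N l)) {M : ℝ≥0}
    (hM : ∀ l, eLpNorm (q l).toFun ∞ volume ≤ M) :
    IsCompact (closure (Set.range fun l => (q l).toBoundedContinuousFunction)) := by
  refine BoundedContinuousFunction.arzela_ascoli (Metric.closedBall 0 M)
    (isCompact_closedBall _ _) _ ?_ ?_
  · rintro _ u ⟨l, rfl⟩
    rw [mem_closedBall_zero_iff]
    exact (q l).norm_toFun_le_of_eLpNorm_le (hM l) u
  · refine (LipschitzWith.uniformEquicontinuous _ 1 ?_).equicontinuous
    rintro ⟨_, l, rfl⟩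
    exact (q l).lipschitzWith_toFun

theorem tendsto_sobolevNorm_sub {d : ℕ} {N : ℕ → ℕ} (q : ∀ l, EquilateralPolygon d (N l))
    {γ : UnitAddCircle → EuclideanSpace ℝ (Fin d)} {g : ℝ → EuclideanSpace ℝ (Fin d)}
    (hγ : ∀ x : ℝ, HasDerivAt (fun y : ℝ => γ (y : UnitAddCircle)) (g x) x)
    (hF : TendstoUniformly (fun l => (q l).lift) (fun y : ℝ => γ (y : UnitAddCircle)) atTop)
    (hT : TendstoUniformly (fun l => (q l).rightTangent) g atTop) :
    Tendsto (fun l => sobolevNorm ((q l).toFun - γ)) atTop (𝓝 0) := by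
  rw [ENNReal.tendsto_nhds_zero]
  intro ε hε
  obtain ⟨δ, hδ, hδε⟩ : ∃ δ : ℝ≥0, 0 < δ ∧ (δ : ℝ≥0∞) < ε / 2 := by
    obtain ⟨δ, h1, h2⟩ := ENNReal.lt_iff_exists_nnreal_btwn.1 (ENNReal.half_pos hε.ne')
    exact ⟨δ, by exact_mod_cast h1, h2⟩
  have hδ' : (0 : ℝ) < δ := hδ
  filter_upwards [Metric.tendstoUniformly_iff.1 hF δ hδ', Metric.tendstoUniformly_iff.1 hT δ hδ']
    with l h1 h2
  have hbound : ∀ f : UnitAddCircle → EuclideanSpace ℝ (Fin d),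
      (∀ x : ℝ, ‖f (x : UnitAddCircle)‖ ≤ δ) → eLpNorm f ∞ volume ≤ ε / 2 := by
    intro f hf
    rw [eLpNorm_exponent_top]
    refine (eLpNormEssSup_le_of_ae_bound (C := δ) (Eventually.of_forall fun u => ?_)).trans ?_
    · obtain ⟨x, rfl⟩ := QuotientAddGroup.mk_surjective u
      exact hf x
    · rw [ENNReal.ofReal_coe_nnreal]
      exact hδε.le
  refine (add_le_add (hbound _ fun x => ?_) (hbound _ fun x => ?_)).trans_eq (ENNReal.add_halves ε)
  · have := (h1 x).le
    rwa [dist_comm, dist_eq_norm] at this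
  · have := (h2 x).le
    rw [dist_comm, dist_eq_norm] at this
    exact (norm_circleDeriv_le_of_hasDerivWithinAt
      (((q l).hasDerivWithinAt_lift x).sub (hγ x).hasDerivWithinAt)).trans this

/-- Compactness of polygons whose curvature bounds `C l` converge. -/
theorem exists_subseq_tendsto_of_maxCurv_le {d : ℕ} {N : ℕ → ℕ}
    (q : ∀ l, EquilateralPolygon d (N l)) (hN : Tendsto N atTop atTop) {M : ℝ≥0}
    (hM : ∀ l, eLpNorm (q l).toFun ∞ volume ≤ M) {C : ℕ → ℝ} {K : ℝ}
    (hC : ∀ l, 0 ≤ C l) (hCK : Tendsto C atTop (𝓝 K))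
    (hcurv : ∀ l, (q l).maxCurv ≤ ENNReal.ofReal (C l)) :
    ∃ γ : UnitAddCircle → EuclideanSpace ℝ (Fin d), IsC11 γ ∧ IsArcLengthCurve γ ∧
      maxCurv γ ≤ ENNReal.ofReal K ∧ ∃ φ : ℕ → ℕ, StrictMono φ ∧
        Tendsto (fun l => sobolevNorm ((q (φ l)).toFun - γ)) atTop (𝓝 0) := by
  have hK : 0 ≤ K := ge_of_tendsto' hCK hC
  obtain ⟨γ, -, φ, hφ, hlim⟩ := (isCompact_closure_range_toBoundedContinuousFunction q hM)
    |>.tendsto_subseq fun l => subset_closure (Set.mem_range_self l)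
  have hunif : TendstoUniformly (fun l => (q (φ l)).lift) (fun y : ℝ => γ (y : UnitAddCircle))
      atTop :=
    (BoundedContinuousFunction.tendsto_iff_tendstoUniformly.1 hlim).comp
      (fun y : ℝ => (y : UnitAddCircle))
  have hr : Tendsto (fun l => 1 / (N (φ l) : ℝ)) atTop (𝓝 0) :=
    tendsto_one_div_atTop_nhds_zero_nat.comp (hN.comp hφ.tendsto_atTop)
  obtain ⟨g, hTg, hg, hderiv⟩ := exists_hasDerivAt_of_tendstoUniformly
    (fun l => hC (φ l)) (hCK.comp hφ.tendsto_atTop) (fun l => by positivity) hr hunif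
    (fun l x t ht => EquilateralPolygon.norm_lift_add_sub_sub_le (hC _) (hcurv (φ l)) x ht)
    (fun l => EquilateralPolygon.norm_rightTangent_sub_le (hC _) (hcurv (φ l)))
  have hcd : ∀ x : ℝ, circleDeriv γ (x : UnitAddCircle) = g x := fun x => by
    rw [circleDeriv_coe, (hderiv x).deriv]
  have hg1 : ∀ x, ‖g x‖ = 1 := fun x =>
    tendsto_nhds_unique (hTg.tendsto_at x).norm
      (by simp only [EquilateralPolygon.norm_rightTangent]; exact tendsto_const_nhds)
  have hspeed : ∀ u, ‖circleDeriv γ u‖ = 1 := by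
    intro u
    obtain ⟨x, rfl⟩ := QuotientAddGroup.mk_surjective u
    exact (congrArg norm (hcd x)).trans (hg1 x)
  have hlip : ∀ x y : ℝ, ‖circleDeriv γ (x : UnitAddCircle) - circleDeriv γ (y : UnitAddCircle)‖
      ≤ K * |x - y| := fun x y => by rw [hcd, hcd]; exact hg x y
  have hlip' : LipschitzWith K.toNNReal (circleDeriv γ) :=
    lipschitzWith_of_lift fun x y => by rw [Real.coe_toNNReal K hK]; exact hlip x y
  refine ⟨γ, ⟨?_, K.toNNReal, hlip'⟩, ⟨⟨1, ?_⟩, Eventually.of_forall hspeed, ?_⟩, ?_, φ, hφ,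
    tendsto_sobolevNorm_sub (fun l => q (φ l)) hderiv hunif hTg⟩
  · rw [contDiff_one_iff_deriv]
    refine ⟨fun x => (hderiv x).differentiableAt, ?_⟩
    have : deriv (fun y : ℝ => γ (y : UnitAddCircle)) = fun x : ℝ => circleDeriv γ x :=
      funext fun x => (circleDeriv_coe γ x).symm
    rw [this]
    exact hlip'.continuous.comp (AddCircle.continuous_mk' 1)
  · refine lipschitzWith_of_lift fun x y => ?_
    exact le_of_tendsto' ((hunif.tendsto_at x).sub (hunif.tendsto_at y)).norm
      fun l => by
        rw [NNReal.coe_one, one_mul]; exact (q (φ l)).norm_lift_sub_le x y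
  · have : ∀ u, ‖circleDeriv γ u‖ₑ = 1 := fun u => by
      rw [← ofReal_norm, hspeed, ENNReal.ofReal_one]
    simp [this]
  · rw [maxCurv, eLpNorm_exponent_top]
    exact eLpNormEssSup_le_of_ae_bound
      (Eventually.of_forall (norm_circleDeriv_le_of_lipschitzWith hK hlip))

end DiscreteThickness

theorem proposition3 (d n₀ : ℕ)
    (p : ∀ j : ℕ, DiscreteThickness.EquilateralPolygon d (n₀ + j))
    (hbdd : ∃ M : ℝ≥0, ∀ j : ℕ, eLpNorm (p j).toFun ∞ volume ≤ M)
    (hcurv : liminf (fun j : ℕ => (p j).maxCurv) atTop < ∞) :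
    ∃ γ : UnitAddCircle → EuclideanSpace ℝ (Fin d),
      DiscreteThickness.IsC11 γ ∧
      DiscreteThickness.IsArcLengthCurve γ ∧
      DiscreteThickness.maxCurv γ ≤ liminf (fun j : ℕ => (p j).maxCurv) atTop ∧
      ∃ k : ℕ → ℕ, StrictMono k ∧
        Tendsto (fun l : ℕ => DiscreteThickness.sobolevNorm ((p (k l)).toFun - γ))
          atTop (𝓝 0) := by
  obtain ⟨M, hM⟩ := hbdd
  set L := liminf (fun j : ℕ => (p j).maxCurv) atTop with hL
  have hpos : ∀ l : ℕ, (0 : ℝ) < 1 / ((l : ℝ) + 1) := fun l => Nat.one_div_pos_of_nat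
  -- Only infinitely many polygons need have curvature near `L`; the extraction makes the `l`-th
  -- selected one obey the bound `L + 1 / (l + 1)`.
  have hfreq : ∀ l : ℕ, ∃ᶠ j in atTop,
      (p j).maxCurv < L + ENNReal.ofReal (1 / ((l : ℝ) + 1)) := fun l =>
    frequently_lt_of_liminf_lt (h := hL ▸ ENNReal.lt_add_right hcurv.ne
      (ENNReal.ofReal_pos.2 (hpos l)).ne')
  obtain ⟨ψ, hψ, hlt⟩ := extraction_forall_of_frequently hfreq
  obtain ⟨γ, h1, h2, h3, φ, hφ, h4⟩ := DiscreteThickness.exists_subseq_tendsto_of_maxCurv_le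
    (fun l => p (ψ l)) (tendsto_atTop_mono (fun l => (Nat.le_add_left (ψ l) n₀)) hψ.tendsto_atTop)
    (fun l => hM (ψ l)) (C := fun l : ℕ => L.toReal + 1 / ((l : ℝ) + 1)) (K := L.toReal)
    (fun l => add_nonneg ENNReal.toReal_nonneg (hpos l).le)
    (by simpa using tendsto_one_div_add_atTop_nhds_zero_nat.const_add L.toReal)
    (fun l => by
      rw [ENNReal.ofReal_add ENNReal.toReal_nonneg (hpos l).le, ENNReal.ofReal_toReal hcurv.ne]
      exact (hlt l).le)
  rw [ENNReal.ofReal_toReal hcurv.ne] at h3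
  exact ⟨γ, h1, h2, h3, ψ ∘ φ, hψ.comp hφ, h4⟩
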